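/- Let $X$ be a metric space that is a Suslin space (a continuous image of a Polish space), and let $Y$ be a separable Fréchet space: a separable, locally convex real topological vector space whose topology is given by a fixed complete translation-invariant metric. Let $\alpha$ be a countable successor ordinal (so $\alpha\ge 1$), and let $f:X\to Y$ be a function with graph $gr(f)\subseteq X\times Y$. A function is Baire-$0$ if it is continuous; for a countable ordinal $\alpha>0$ it is Baire-$\alpha$ if it is the pointwise limit of a sequence of functions $f_n$, where each $f_n$ is Baire-$\alpha_n$ for some $\alpha_n<\alpha$. A subset of a topological space is in $\Sigma_1$ if it is open; for $\alpha\geq 1$ it is in $\Pi_\alpha$ if its complement is in $\Sigma_\alpha$; and for $\alpha>1$ it is in $\Sigma_\alpha$ if it is a union $\bigcup_{i=1}^\infty A_i$ with each $A_i\in\Pi_{\alpha_i}$ for some $1\le\alpha_i<\alpha$. A $\Sigma_\alpha$ strip is a $\Sigma_\alpha$ set $S\subseteq X\times Y$ whose vertical section $S(x)=\{y\in Y:(x,y)\in S\}$ is convex for every $x\in X$. Then $f$ is Baire-$\alpha$ if and only if there is a nested sequence $G_1\supseteq G_2\supseteq\dots$ of $\Sigma_\alpha$ strips in $X\times Y$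 such that 1. $\bigcap_{n=1}^\infty G_n=gr(f)$; 2. $\operatorname{diam}(G_n(x))\to 0$ as $n\to\infty$ for every $x\in X$; 3. for every $n$ and every open set $U\subseteq Y$, the projection of $(X\times U)\cap G_n$ to $X$ is in $\Sigma_\alpha$. -/

import Mathlib

open Filter Topology
open scoped Ordinal

/-- A Suslin space: a continuous image of a Polish space. In Mathlib's terms, the whole space is
an analytic set (see `MeasureTheory.analyticSet_iff_exists_polishSpace_range`). -/
def IsSuslinSpace (X : Type*) [TopologicalSpace X] : Prop :=
  MeasureTheory.AnalyticSet (Set.univ : Set X)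

/-- `IsSigma α A`: the set `A` is of additive Borel class `α` (`α ≥ 1`), where the sets of additive
class `1` are the open sets, and for `α > 1` the sets of additive class `α` are the countable
unions of sets `A i` of multiplicative classes `a i < α`, that is, of sets whose complements are of
additive class `a i`. No set has additive class `0`, so `a i ≥ 1` is automatic. -/
inductive IsSigma {X : Type*} [TopologicalSpace X] : Ordinal.{0} → Set X → Prop
  | of_isOpen {A : Set X} (hA : IsOpen A) : IsSigma 1 A
  | iUnion {α : Ordinal.{0}} (hα : 1 < α) (a : ℕ → Ordinal.{0}) (A : ℕ → Set X)
      (ha : ∀ i, a i < α) (hA : ∀ i, IsSigma (a i) (A i)ᶜ) : IsSigma α (⋃ i, A i)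

/-- `IsBaireClass α f`: the function `f` is Baire-`α`. Baire-`0` means continuous, and for `α > 0`
a function is Baire-`α` if it is the pointwise limit of a sequence of functions `F n`, each of which
is Baire-`a n` for some `a n < α`. -/
inductive IsBaireClass {X Y : Type*} [TopologicalSpace X] [TopologicalSpace Y] :
    Ordinal.{0} → (X → Y) → Prop
  | of_continuous {f : X → Y} (hf : Continuous f) : IsBaireClass 0 f
  | of_tendsto {α : Ordinal.{0}} {f : X → Y} (a : ℕ → Ordinal.{0}) (F : ℕ → X → Y)
      (ha : ∀ n, a n < α) (hF : ∀ n, IsBaireClass (a n) (F n))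
      (hlim : ∀ x, Tendsto (fun n => F n x) atTop (𝓝 (f x))) : IsBaireClass α f

/-- The vertical section of a subset of `X × Y` above the point `x`, viewed as a subset of `Y`. -/
def verticalSection {X Y : Type*} (S : Set (X × Y)) (x : X) : Set Y :=
  {y | (x, y) ∈ S}

/-- A `Σ_α` strip: a subset of `X × Y` of additive class `α` all of whose vertical sections are
convex. -/
def IsSigmaStrip {X Y : Type*} [TopologicalSpace X] [TopologicalSpace Y] [AddCommGroup Y]
    [Module ℝ Y] (α : Ordinal.{0}) (S : Set (X × Y)) : Prop :=
  IsSigma α S ∧ ∀ x : X, Convex ℝ (verticalSection S x)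

/-! Write `α = b + 1`. If `f` is the limit of Baire-`b` functions `F m`, let `G n` consist of the
points within `V n` of a rational convex combination of the `F m x`, `m ≥ n`, where `V n` is a
shrinking basis of open convex neighbourhoods of `0`. There are countably many rational weights, and
Baire-`b` maps pull open sets back to `Σ_{b+1}` sets (`isSigma_preimage`), so `G n` and its
projections are `Σ_{b+1}`; local convexity makes the sections shrink to `f x`.

Conversely, the projection condition yields Baire-`b` functions `g n` with `g n x ∈ G n x + V n`
(`exists_baire_approximate_selection`), and these converge to `f`. For `b = 0` the selection comes
from a partition of unity; for `b ≥ 1` it takes countably many values, and its class is found by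
induction on `b` (`comp_least_index`). -/

open Set
open scoped Pointwise

/-! ### Closure properties of the additive classes -/

namespace IsSigma

section

variable {X : Type*} [TopologicalSpace X]

theorem one_le {a : Ordinal.{0}} {A : Set X} (h : IsSigma a A) : 1 ≤ a := by
  cases h with
  | of_isOpen => exact le_rfl
  | iUnion hα => exact hα.le

theorem isOpen {A : Set X} (h : IsSigma 1 A) : IsOpen A := by
  generalize hb : (1 : Ordinal.{0}) = b at h
  cases h with
  | of_isOpen hA => exact hA
  | iUnion hα => exact absurd hb hα.ne

theorem exists_eq_iUnion {a : Ordinal.{0}} (ha : 1 < a) {A : Set X} (h : IsSigma a A) :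
    ∃ (b : ℕ → Ordinal.{0}) (B : ℕ → Set X),
      (∀ i, b i < a) ∧ (∀ i, IsSigma (b i) (B i)ᶜ) ∧ A = ⋃ i, B i := by
  cases h with
  | of_isOpen hA => exact absurd ha (lt_irrefl _)
  | iUnion hα b B hb hB => exact ⟨b, B, hb, hB, rfl⟩

theorem of_compl {a b : Ordinal.{0}} {A : Set X} (h : IsSigma a Aᶜ) (hab : a < b) :
    IsSigma b A := by
  have := IsSigma.iUnion (h.one_le.trans_lt hab) (fun _ : ℕ => a) (fun _ => A) (fun _ => hab)
    (fun _ => h)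
  rwa [iUnion_const] at this

end

variable {X : Type*} [PseudoMetricSpace X]

/-- The metric enters at class `1`: an open set is a countable union of closed sets. -/
theorem mono {a b : Ordinal.{0}} {A : Set X} (h : IsSigma a A) (hab : a ≤ b) :
    IsSigma b A := by
  rcases hab.eq_or_lt with rfl | hab
  · exact h
  cases h with
  | of_isOpen hA =>
    obtain ⟨F, hF, -, hU, -⟩ := hA.exists_iUnion_isClosed
    rw [← hU]
    exact .iUnion hab (fun _ => 1) F (fun _ => hab) fun i => .of_isOpen (hF i).isOpen_compl
  | iUnion hα c B hc hB => exact .iUnion (hα.trans hab) c B (fun i => (hc i).trans hab) hB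

theorem of_isOpen_of_le {a : Ordinal.{0}} (ha : 1 ≤ a) {A : Set X} (h : IsOpen A) :
    IsSigma a A :=
  (IsSigma.of_isOpen h).mono ha

theorem iUnion_nat {a : Ordinal.{0}} {A : ℕ → Set X} (h : ∀ i, IsSigma a (A i)) :
    IsSigma a (⋃ i, A i) := by
  rcases (h 0).one_le.eq_or_lt with rfl | ha
  · exact .of_isOpen (isOpen_iUnion fun i => (h i).isOpen)
  choose b B hb hB hA using fun i => (h i).exists_eq_iUnion ha
  have : ⋃ i, A i = ⋃ k : ℕ, B k.unpair.1 k.unpair.2 := by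
    rw [iUnion_unpair]
    exact iUnion_congr hA
  rw [this]
  exact .iUnion ha (fun k => b k.unpair.1 k.unpair.2) _ (fun _ => hb _ _) fun _ => hB _ _

theorem iUnion_countable {ι : Type*} [Countable ι] {a : Ordinal.{0}} (ha : 1 ≤ a)
    {A : ι → Set X} (h : ∀ i, IsSigma a (A i)) : IsSigma a (⋃ i, A i) := by
  cases isEmpty_or_nonempty ι with
  | inl _ => rw [iUnion_of_empty]; exact of_isOpen_of_le ha isOpen_empty
  | inr _ =>
    obtain ⟨e, he⟩ := exists_surjective_nat ι
    rw [← he.iUnion_comp]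
    exact iUnion_nat fun i => h _

theorem union {a : Ordinal.{0}} {A B : Set X} (hA : IsSigma a A) (hB : IsSigma a B) :
    IsSigma a (A ∪ B) := by
  rw [union_eq_iUnion]
  exact iUnion_countable hA.one_le (by rintro (_ | _) <;> assumption)

theorem inter {a : Ordinal.{0}} {A B : Set X} (hA : IsSigma a A) (hB : IsSigma a B) :
    IsSigma a (A ∩ B) := by
  rcases hA.one_le.eq_or_lt with rfl | ha
  · exact .of_isOpen (hA.isOpen.inter hB.isOpen)
  obtain ⟨c, C, hc, hC, rfl⟩ := hA.exists_eq_iUnion ha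
  obtain ⟨d, D, hd, hD, rfl⟩ := hB.exists_eq_iUnion ha
  have : (⋃ i, C i) ∩ ⋃ j, D j = ⋃ p : ℕ × ℕ, C p.1 ∩ D p.2 := by
    ext x
    simp
  rw [this]
  refine iUnion_countable ha.le fun p : ℕ × ℕ => of_compl (a := max (c p.1) (d p.2)) ?_
    (max_lt (hc _) (hd _))
  rw [compl_inter]
  exact ((hC _).mono (le_max_left _ _)).union ((hD _).mono (le_max_right _ _))

theorem setOf_forall_lt {a : Ordinal.{0}} (ha : 1 ≤ a) {A : ℕ → Set X} {n : ℕ}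
    (h : ∀ i < n, IsSigma a (A i)) : IsSigma a {x | ∀ i < n, x ∈ A i} := by
  induction n with
  | zero => simpa using of_isOpen_of_le ha isOpen_univ
  | succ n ih =>
    have : {x | ∀ i < n + 1, x ∈ A i} = {x | ∀ i < n, x ∈ A i} ∩ A n := by
      ext x
      exact Nat.forall_lt_succ_right
    rw [this]
    exact (ih fun i hi => h i (hi.trans n.lt_succ_self)).inter (h n n.lt_succ_self)

theorem setOf_const_and {a : Ordinal.{0}} {p : Prop} {A : Set X} (h : IsSigma a A) :
    IsSigma a {x | p ∧ x ∈ A} := by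
  by_cases hp : p
  · simpa [hp] using h
  · simpa [hp] using of_isOpen_of_le h.one_le isOpen_empty

end IsSigma

/-! ### Baire classes and preimages of open sets -/

namespace IsBaireClass

section

variable {X Y Z W : Type*} [TopologicalSpace X] [TopologicalSpace Y] [TopologicalSpace Z]
  [TopologicalSpace W]

theorem mono {a b : Ordinal.{0}} {f : X → Y} (h : IsBaireClass a f) (hab : a ≤ b) :
    IsBaireClass b f := by
  rcases hab.eq_or_lt with rfl | hab
  · exact h
  · exact .of_tendsto (fun _ => a) (fun _ => f) (fun _ => hab) (fun _ => h)
      fun _ => tendsto_const_nhds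

theorem exists_tendsto {a : Ordinal.{0}} (ha : 0 < a) {f : X → Y} (h : IsBaireClass a f) :
    ∃ (b : ℕ → Ordinal.{0}) (F : ℕ → X → Y), (∀ n, b n < a) ∧
      (∀ n, IsBaireClass (b n) (F n)) ∧ ∀ x, Tendsto (fun n => F n x) atTop (𝓝 (f x)) := by
  cases h with
  | of_continuous hf => exact absurd ha (lt_irrefl _)
  | of_tendsto b F hb hF hlim => exact ⟨b, F, hb, hF, hlim⟩

theorem continuous {f : X → Y} (h : IsBaireClass 0 f) : Continuous f := by
  generalize hb : (0 : Ordinal.{0}) = b at h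
  cases h with
  | of_continuous hf => exact hf
  | of_tendsto a F ha => exact absurd (hb ▸ ha 0) not_lt_zero

theorem comp_continuous {a : Ordinal.{0}} {f : X → Y} (h : IsBaireClass a f) {φ : Z → X}
    (hφ : Continuous φ) : IsBaireClass a (fun z => f (φ z)) := by
  induction h with
  | of_continuous hf => exact .of_continuous (hf.comp hφ)
  | of_tendsto b F hb hF hlim ih => exact .of_tendsto b _ hb ih fun z => hlim (φ z)

theorem continuous_comp₂ {φ : Y × Z → W} (hφ : Continuous φ) {a : Ordinal.{0}} {f : X → Y}
    {g : X → Z} (hf : IsBaireClass a f) (hg : IsBaireClass a g) :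
    IsBaireClass a (fun x => φ (f x, g x)) := by
  induction a using WellFoundedLT.induction generalizing f g with
  | ind a ih =>
    rcases eq_zero_or_pos a with rfl | ha
    · exact .of_continuous (hφ.comp (hf.continuous.prodMk hg.continuous))
    obtain ⟨b, F, hb, hF, hFlim⟩ := hf.exists_tendsto ha
    obtain ⟨c, G, hc, hG, hGlim⟩ := hg.exists_tendsto ha
    refine .of_tendsto (fun n => max (b n) (c n)) (fun n x => φ (F n x, G n x))
      (fun n => max_lt (hb n) (hc n)) (fun n => ?_) fun x => ?_
    · exact ih _ (max_lt (hb n) (hc n)) ((hF n).mono (le_max_left _ _))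
        ((hG n).mono (le_max_right _ _))
    · exact (hφ.tendsto _).comp ((hFlim x).prodMk_nhds (hGlim x))

theorem const (a : Ordinal.{0}) (c : Y) : IsBaireClass a (fun _ : X => c) :=
  (IsBaireClass.of_continuous continuous_const).mono zero_le

theorem finsetSum_smul [AddCommGroup Y] [Module ℝ Y] [IsTopologicalAddGroup Y]
    [ContinuousSMul ℝ Y] {ι : Type*} {a : Ordinal.{0}} (s : Finset ι) (w : ι → ℝ)
    {F : ι → X → Y} (hF : ∀ i, IsBaireClass a (F i)) :
    IsBaireClass a (fun x => ∑ i ∈ s, w i • F i x) := by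
  classical
  induction s using Finset.induction_on with
  | empty => simpa using const a 0
  | insert i s hi ih =>
    simp only [Finset.sum_insert hi]
    exact continuous_comp₂ (φ := fun p : Y × Y => w i • p.1 + p.2) (by fun_prop) (hF i) ih

end

/-- Exhaust `U` by closed sets `K k`. The limit lies in `U` iff, for some `k`, the sequence is
eventually in `K k`; each tail condition is the complement of a countable union of `Σ_a` sets. -/
theorem isSigma_preimage {X Y : Type*} [PseudoMetricSpace X] [PseudoEMetricSpace Y]
    {a : Ordinal.{0}} {f : X → Y} (h : IsBaireClass a f) {U : Set Y} (hU : IsOpen U) :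
    IsSigma (Order.succ a) (f ⁻¹' U) := by
  induction h generalizing U with
  | of_continuous hf =>
    rw [Order.succ_eq_add_one, zero_add]
    exact .of_isOpen (hU.preimage hf)
  | @of_tendsto a f b F hb hF hlim ih =>
    have ha : 1 ≤ a := Order.one_le_iff_pos.2 (zero_le.trans_lt (hb 0))
    -- The extended distance to the empty set is `∞`, so `U = univ` needs no separate case.
    set K : ℕ → Set Y := fun k => {y | (k : ENNReal)⁻¹ ≤ Metric.infEDist y Uᶜ}
    have hK : ∀ k, IsClosed (K k) := fun k =>
      isClosed_le continuous_const Metric.continuous_infEDist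
    have hpos : ∀ y, y ∈ U ↔ 0 < Metric.infEDist y Uᶜ := fun y => by
      rw [← not_iff_not, not_lt, nonpos_iff_eq_zero,
        ← Metric.mem_iff_infEDist_zero_of_closed hU.isClosed_compl, mem_compl_iff]
    have hKU : ∀ k, K k ⊆ U := fun k y hy =>
      (hpos y).2 (lt_of_lt_of_le (ENNReal.inv_pos.2 (ENNReal.natCast_ne_top k)) hy)
    have key : f ⁻¹' U = ⋃ p : ℕ × ℕ, {x | ∀ n, p.2 ≤ n → F n x ∈ K p.1} := by
      ext x
      simp only [mem_preimage, mem_iUnion, mem_ofPred_eq, Prod.exists]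
      constructor
      · intro hx
        obtain ⟨k, hk⟩ := ENNReal.exists_inv_nat_lt ((hpos _).1 hx).ne'
        have := ((Metric.continuous_infEDist (s := Uᶜ)).tendsto (f x)).comp (hlim x)
        obtain ⟨N, hN⟩ := eventually_atTop.1 (this.eventually (lt_mem_nhds hk))
        exact ⟨k, N, fun n hn => (hN n hn).le⟩
      · rintro ⟨k, N, h⟩
        exact hKU k ((hK k).mem_of_tendsto (hlim x) (eventually_atTop.2 ⟨N, h⟩))
    rw [key]
    refine IsSigma.iUnion_countable (ha.trans (Order.le_succ a)) fun p => ?_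
    refine IsSigma.of_compl (a := a) ?_ (Order.lt_succ a)
    have : {x | ∀ n, p.2 ≤ n → F n x ∈ K p.1}ᶜ =
        ⋃ n, {x | p.2 ≤ n ∧ x ∈ F n ⁻¹' (K p.1)ᶜ} := by
      ext x
      simp
    rw [this]
    exact IsSigma.iUnion_nat fun n =>
      (((ih n (hK p.1).isOpen_compl).mono (Order.succ_le_of_lt (hb n)))).setOf_const_and

/-! ### Countably valued functions of a given Baire class -/

section StepFunctions

variable {X Y : Type*} [PseudoMetricSpace X]

/-- Refining a countable cover by sets of additive class `b + 1` to a cover by sets of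
multiplicative class `b` and picking the least index gives a selection of the original cover. -/
theorem exists_least_index {b : Ordinal.{0}} (hb : 1 ≤ b) {A : ℕ → Set X}
    (hA : ∀ i, IsSigma (Order.succ b) (A i)) (hcover : ∀ x, ∃ i, x ∈ A i) :
    ∃ (P : ℕ → Set X) (e : ℕ → ℕ) (φ : X → ℕ), (∀ m, IsSigma b (P m)ᶜ) ∧
      (∀ x, x ∈ P (φ x)) ∧ (∀ x, ∀ m < φ x, x ∉ P m) ∧ ∀ x, x ∈ A (e (φ x)) := by
  classical
  choose c B hc hB hAB using fun i => (hA i).exists_eq_iUnion (Order.lt_succ_of_le hb)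
  have hex : ∀ x, ∃ m : ℕ, x ∈ B m.unpair.1 m.unpair.2 := fun x => by
    obtain ⟨i, hi⟩ := hcover x
    rw [hAB i] at hi
    obtain ⟨j, hj⟩ := mem_iUnion.1 hi
    exact ⟨Nat.pair i j, by simpa using hj⟩
  refine ⟨fun m => B m.unpair.1 m.unpair.2, fun m => m.unpair.1, fun x => Nat.find (hex x),
    fun m => (hB _ _).mono (Order.lt_succ_iff.1 (hc _ _)), fun x => Nat.find_spec (hex x),
    fun x m hm => Nat.find_min (hex x) hm, fun x => ?_⟩
  rw [hAB]
  exact mem_iUnion.2 ⟨_, Nat.find_spec (hex x)⟩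

variable [AddCommGroup Y] [Module ℝ Y] [TopologicalSpace Y]
  [IsTopologicalAddGroup Y] [ContinuousSMul ℝ Y]

/-- Continuous `u n m` equal `1` on `P m` and are eventually `0` at each point off it, so the weight
`u n m * ∏ k < m, (1 - u n k)` is eventually the indicator of `φ = m`. -/
theorem comp_least_index_one {P : ℕ → Set X} (hP : ∀ m, IsClosed (P m)) {φ : X → ℕ}
    (hφ : ∀ x, x ∈ P (φ x)) (hmin : ∀ x, ∀ m < φ x, x ∉ P m) (y : ℕ → Y) :
    IsBaireClass 1 (fun x => y (φ x)) := by
  have hδ : ∀ n : ℕ, 0 < 1 / ((n : ℝ) + 1) := fun n => Nat.one_div_pos_of_nat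
  set u : ℕ → ℕ → X → ℝ := fun n m x => (thickenedIndicator (hδ n) (P m) x : ℝ)
  have hu : ∀ n m, Continuous (u n m) := fun n m => by
    exact NNReal.continuous_coe.comp (thickenedIndicator (hδ n) (P m)).continuous
  have hu1 : ∀ n m x, x ∈ P m → u n m x = 1 := fun n m x hx => by
    simp only [u, thickenedIndicator_one (hδ n) (P m) hx, NNReal.coe_one]
  have hu0 : ∀ m x, x ∉ P m → ∀ᶠ n in atTop, u n m x = 0 := fun m x hx => by
    have hpos : 0 < Metric.infEDist x (P m) := by
      rw [pos_iff_ne_zero]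
      exact fun h => hx ((Metric.mem_iff_infEDist_zero_of_closed (hP m)).2 h)
    have hlim : Tendsto (fun n : ℕ => ENNReal.ofReal (1 / ((n : ℝ) + 1))) atTop (𝓝 0) := by
      simpa using ENNReal.tendsto_ofReal (tendsto_one_div_add_atTop_nhds_zero_nat (𝕜 := ℝ))
    filter_upwards [hlim.eventually (gt_mem_nhds hpos)] with n hn
    have : x ∉ Metric.thickening (1 / ((n : ℝ) + 1)) (P m) := fun h =>
      (Metric.mem_thickening_iff_infEDist_lt.1 h).not_gt hn
    simp only [u, thickenedIndicator_zero (hδ n) (P m) this, NNReal.coe_zero]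
  refine .of_tendsto (fun _ => 0)
    (fun n x => ∑ m ∈ Finset.range n, (u n m x * ∏ k ∈ Finset.range m, (1 - u n k x)) • y m)
    (fun _ => zero_lt_one) (fun n => .of_continuous (by fun_prop)) fun x => ?_
  refine tendsto_const_nhds.congr' ?_
  have h0 : ∀ᶠ n in atTop, ∀ m ∈ Finset.range (φ x), u n m x = 0 :=
    (Filter.eventually_all_finset _).2 fun m hm =>
      hu0 m x (hmin x m (Finset.mem_range.1 hm))
  filter_upwards [h0, eventually_gt_atTop (φ x)] with n hn hlt
  rw [Finset.sum_eq_single (φ x)]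
  · rw [hu1 n _ x (hφ x), Finset.prod_congr rfl fun k hk => by rw [hn k hk, sub_zero]]
    simp
  · intro m _ hne
    rcases hne.lt_or_gt with hm | hm
    · simp [hn m (Finset.mem_range.2 hm)]
    · rw [Finset.prod_eq_zero (Finset.mem_range.2 hm) (by rw [hu1 n _ x (hφ x), sub_self])]
      simp
  · exact fun h => absurd (Finset.mem_range.2 hlt) h

/-- Each `P m` is an intersection of sets of lower additive class. Truncating to finitely many
conditions gives least-index functions `ψ n` of lower class, which stabilise pointwise at `φ`. -/
theorem comp_least_index {b : Ordinal.{0}} (hb : 1 ≤ b) {P : ℕ → Set X}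
    (hP : ∀ m, IsSigma b (P m)ᶜ) {φ : X → ℕ} (hφ : ∀ x, x ∈ P (φ x))
    (hmin : ∀ x, ∀ m < φ x, x ∉ P m) (y : ℕ → Y) :
    IsBaireClass b (fun x => y (φ x)) := by
  classical
  induction b using WellFoundedLT.induction generalizing P φ y with
  | ind b ih =>
    rcases hb.eq_or_lt with rfl | hb
    · exact comp_least_index_one (fun m => isOpen_compl_iff.1 (hP m).isOpen) hφ hmin y
    choose c B hc hB hPB using fun m => (hP m).exists_eq_iUnion hb
    have hmem : ∀ x m, x ∈ P m ↔ ∀ j, x ∉ B m j := fun x m => by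
      rw [← notMem_compl_iff, hPB m]
      simp
    -- Finitely many classes below `b` have a common bound below `b`, even when `b` is a limit.
    have hsup : ∀ n : ℕ, ∃ d, 1 ≤ d ∧ d < b ∧ ∀ m < n, ∀ j < n, c m j ≤ d := fun n => by
      set s := Finset.range n ×ˢ Finset.range n
      refine ⟨max 1 (s.sup fun p => c p.1 p.2), le_max_left _ _, max_lt hb ?_, ?_⟩
      · exact (Finset.sup_lt_iff (zero_lt_one.trans hb)).2 fun p _ => hc _ _
      · intro m hm j hj
        refine le_max_of_le_right (Finset.le_sup (f := fun p : ℕ × ℕ => c p.1 p.2)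
          (b := (m, j)) ?_)
        simp [s, hm, hj]
    choose d hd1 hdb hcd using hsup
    -- For `m ≥ n` this is the whole space, so a least index always exists.
    set R : ℕ → ℕ → Set X := fun n m => {x | m < n → ∀ j < n, x ∉ B m j}
    have hex : ∀ n x, ∃ m, x ∈ R n m := fun n x => ⟨n, fun h => absurd h (lt_irrefl n)⟩
    set ψ : ℕ → X → ℕ := fun n x => Nat.find (hex n x)
    refine .of_tendsto d (fun n x => y (ψ n x)) hdb (fun n => ?_) fun x => ?_
    · have h1 : 1 ≤ Order.succ (d n) := (hd1 n).trans (Order.le_succ _)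
      have hR : ∀ m, IsSigma (Order.succ (d n)) (R n m) := fun m => by
        by_cases hm : m < n
        · have : R n m = {x | ∀ j < n, x ∈ (B m j)ᶜ} := by
            ext x
            simp [R, hm]
          rw [this]
          exact IsSigma.setOf_forall_lt h1 fun j hj =>
            (hB m j).mono ((hcd n m hm j hj).trans (Order.le_succ _))
        · have : R n m = univ := by
            ext x
            simp [R, hm]
          rw [this]
          exact IsSigma.of_isOpen_of_le h1 isOpen_univ
      have hRc : ∀ m, IsSigma (Order.succ (d n)) (R n m)ᶜ := fun m => by
        have : (R n m)ᶜ = ⋃ j, {x | (m < n ∧ j < n) ∧ x ∈ B m j} := by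
          ext x
          simp [R, and_assoc]
        rw [this]
        refine IsSigma.iUnion_nat fun j => ?_
        by_cases h : m < n ∧ j < n
        · exact ((hB m j).of_compl
            (Order.lt_succ_of_le (hcd n m h.1 j h.2))).setOf_const_and
        · simpa [h] using IsSigma.of_isOpen_of_le h1 (isOpen_empty (X := X))
      have hlevel : ∀ i, IsSigma (Order.succ (d n)) {x | ψ n x = i} := fun i => by
        have : {x | ψ n x = i} = R n i ∩ {x | ∀ m < i, x ∈ (R n m)ᶜ} := by
          ext x
          simp [ψ, Nat.find_eq_iff]
        rw [this]
        exact (hR i).inter (IsSigma.setOf_forall_lt h1 fun m _ => hRc m)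
      -- The level sets of `ψ n` are disjoint, so the selected index `e (φ' x)` must be `ψ n x`.
      obtain ⟨P', e, φ', hP', hφ', hmin', hA'⟩ :=
        exists_least_index (hd1 n) hlevel fun x => ⟨ψ n x, rfl⟩
      have := ih (d n) (hdb n) (hd1 n) hP' hφ' hmin' fun m => y (e m)
      convert this using 3 with x
      exact hA' x
    · have h0 : ∀ᶠ n in atTop, ∀ m ∈ Finset.range (φ x), x ∉ R n m := by
        refine (Filter.eventually_all_finset _).2 fun m hm => ?_
        have hx := hmin x m (Finset.mem_range.1 hm)
        rw [hmem] at hx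
        push Not at hx
        obtain ⟨j, hj⟩ := hx
        filter_upwards [eventually_gt_atTop m, eventually_gt_atTop j] with n hmn hjn h
        exact h hmn j hjn hj
      refine tendsto_const_nhds.congr' ?_
      filter_upwards [h0] with n hn
      have : ψ n x = φ x := (Nat.find_eq_iff _).2
        ⟨fun _ j _ => (hmem x _).1 (hφ x) j, fun m hm => hn m (Finset.mem_range.2 hm)⟩
      rw [this]

/-- A countable cover by sets of additive class `b + 1` has a selection of Baire class `b`. -/
theorem exists_selection_of_cover {b : Ordinal.{0}} (hb : 1 ≤ b) {A : ℕ → Set X}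
    (hA : ∀ i, IsSigma (Order.succ b) (A i)) (hcover : ∀ x, ∃ i, x ∈ A i) (y : ℕ → Y) :
    ∃ g : X → Y, IsBaireClass b g ∧ ∀ x, ∃ i, x ∈ A i ∧ g x = y i := by
  obtain ⟨P, e, φ, hP, hφ, hmin, hmem⟩ := exists_least_index hb hA hcover
  exact ⟨_, comp_least_index hb hP hφ hmin fun m => y (e m), fun x => ⟨_, hmem x, rfl⟩⟩

end StepFunctions

end IsBaireClass

theorem exists_antitone_basis_open_convex (Y : Type*) [AddCommGroup Y] [Module ℝ Y]
    [TopologicalSpace Y] [FirstCountableTopology Y] [IsTopologicalAddGroup Y]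
    [ContinuousSMul ℝ Y] [LocallyConvexSpace ℝ Y] :
    ∃ V : ℕ → Set Y, (∀ n, (0 : Y) ∈ V n ∧ IsOpen (V n) ∧ Convex ℝ (V n)) ∧
      (𝓝 (0 : Y)).HasAntitoneBasis V := by
  obtain ⟨V, hV, hb⟩ :=
    (LocallyConvexSpace.convex_open_basis_zero ℝ Y).exists_antitone_subbasis
  exact ⟨V, hV, hb⟩

/-! ### Approximate selections -/

section ApproximateSelection

variable {X Y : Type*} [PseudoMetricSpace X] [AddCommGroup Y] [Module ℝ Y] [TopologicalSpace Y]
  [IsTopologicalAddGroup Y] [ContinuousSMul ℝ Y] [TopologicalSpace.SeparableSpace Y]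

/-- A convex-valued multifunction whose lower preimages of open sets are of additive class `b + 1`
has approximate selections of Baire class `b`. -/
theorem exists_baire_approximate_selection {b : Ordinal.{0}} {S : X → Set Y}
    (hconv : ∀ x, Convex ℝ (S x)) (hne : ∀ x, (S x).Nonempty)
    (hS : ∀ U : Set Y, IsOpen U → IsSigma (Order.succ b) {x | (U ∩ S x).Nonempty})
    {V : Set Y} (hV0 : (0 : Y) ∈ V) (hVo : IsOpen V) (hVc : Convex ℝ V) :
    ∃ g : X → Y, IsBaireClass b g ∧ ∀ x, ∃ z ∈ S x, g x - z ∈ V := by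
  have hopen : ∀ c : Y, IsOpen {z | c - z ∈ V} := fun c => hVo.preimage (by fun_prop)
  have hset : ∀ c : Y, {x | ({z | c - z ∈ V} ∩ S x).Nonempty} = {x | ∃ z ∈ S x, c - z ∈ V} :=
    fun c => by
      ext x
      exact ⟨fun ⟨z, h1, h2⟩ => ⟨z, h2, h1⟩, fun ⟨z, h1, h2⟩ => ⟨z, h2, h1⟩⟩
  have hA : ∀ c : Y, IsSigma (Order.succ b) {x | ∃ z ∈ S x, c - z ∈ V} := fun c =>
    hset c ▸ hS _ (hopen c)
  rcases eq_zero_or_pos b with rfl | hb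
  -- A fixed `c` is admissible on an open set of `x`, and admissible values form the convex set `S x
  -- + V`, so local constants glue to a continuous function.
  · have hTc : ∀ x, Convex ℝ {c | ∃ z ∈ S x, c - z ∈ V} := fun x => by
      have : {c | ∃ z ∈ S x, c - z ∈ V} = S x + V := by
        ext c
        simp only [mem_ofPred_eq, Set.mem_add]
        exact ⟨fun ⟨z, hz, h⟩ => ⟨z, hz, c - z, h, add_sub_cancel z c⟩,
          fun ⟨z, hz, v, hv, h⟩ => ⟨z, hz, by rwa [← h, add_sub_cancel_left]⟩⟩
      rw [this]
      exact (hconv x).add hVc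
    obtain ⟨g, hg⟩ := exists_continuous_forall_mem_convex_of_local_const hTc fun x => by
      obtain ⟨c, hc⟩ := hne x
      have ho := hA c
      rw [Order.succ_eq_add_one, zero_add] at ho
      exact ⟨c, ho.isOpen.mem_nhds ⟨c, hc, by simpa using hV0⟩⟩
    exact ⟨g, .of_continuous g.continuous, hg⟩
  · obtain ⟨D, hD⟩ := TopologicalSpace.exists_dense_seq Y
    obtain ⟨g, hg, hgs⟩ := IsBaireClass.exists_selection_of_cover
      (Order.one_le_iff_pos.2 hb) (fun i => hA (D i)) (fun x => by
        obtain ⟨z, hz⟩ := hne x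
        obtain ⟨i, hi⟩ := hD.exists_mem_open (hVo.preimage (continuous_sub_right z))
          ⟨z, by simpa using hV0⟩
        exact ⟨i, z, hz, hi⟩) D
    refine ⟨g, hg, fun x => ?_⟩
    obtain ⟨i, hi, h⟩ := hgs x
    rw [h]
    exact hi

end ApproximateSelection

/-! ### Strips built from rational convex hulls -/

section Strips

variable {X Y : Type*} [AddCommGroup Y] [Module ℝ Y]

/-- Finitely supported rational convex weights on the indices `≥ n`. -/
def rationalWeights (n : ℕ) : Set (ℕ →₀ ℚ) :=
  {w | (∀ i, 0 ≤ w i) ∧ (∑ i ∈ w.support, w i = 1) ∧ ∀ i ∈ w.support, n ≤ i}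

/-- The linear combination of the functions `F i` with rational weights `w`. -/
def weightedSum (F : ℕ → X → Y) (w : ℕ →₀ ℚ) (x : X) : Y :=
  ∑ i ∈ w.support, (w i : ℝ) • F i x

/-- The points within `V` of a rational convex combination of the `F m x`, `m ≥ n`. -/
def hullStrip (F : ℕ → X → Y) (V : Set Y) (n : ℕ) : Set (X × Y) :=
  {p | ∃ w ∈ rationalWeights n, p.2 - weightedSum F w p.1 ∈ V}

theorem weightedSum_mem {F : ℕ → X → Y} {n : ℕ} {w : ℕ →₀ ℚ} (hw : w ∈ rationalWeights n)
    {x : X} {C : Set Y} (hC : Convex ℝ C) (h : ∀ i, n ≤ i → F i x ∈ C) :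
    weightedSum F w x ∈ C :=
  hC.sum_mem (fun i _ => by exact_mod_cast hw.1 i) (by exact_mod_cast hw.2.1)
    fun i hi => h i (hw.2.2 i hi)

theorem single_mem_rationalWeights {n m : ℕ} (h : n ≤ m) :
    Finsupp.single m (1 : ℚ) ∈ rationalWeights n := by
  refine ⟨fun i => ?_, ?_, fun i hi => ?_⟩
  · rw [Finsupp.single_apply]
    split_ifs <;> simp
  · rw [Finsupp.support_single _ one_ne_zero]
    simp
  · rw [Finsupp.support_single _ one_ne_zero, Finset.mem_singleton] at hi
    exact hi ▸ h

theorem weightedSum_single (F : ℕ → X → Y) (m : ℕ) (x : X) :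
    weightedSum F (Finsupp.single m 1) x = F m x := by
  rw [weightedSum, Finsupp.support_single _ one_ne_zero]
  simp

theorem weightedSum_smul_add (F : ℕ → X → Y) (q r : ℚ) (v w : ℕ →₀ ℚ) (x : X) :
    weightedSum F (q • v + r • w) x =
      (q : ℝ) • weightedSum F v x + (r : ℝ) • weightedSum F w x := by
  classical
  have h : ∀ u : ℕ →₀ ℚ, u.support ⊆ v.support ∪ w.support →
      weightedSum F u x = ∑ i ∈ v.support ∪ w.support, (u i : ℝ) • F i x := fun u hu =>
    Finset.sum_subset hu fun i _ hi => by simp [Finsupp.notMem_support_iff.1 hi]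
  rw [h _ (Finsupp.support_add.trans (Finset.union_subset_union Finsupp.support_smul
    Finsupp.support_smul)), h v Finset.subset_union_left, h w Finset.subset_union_right,
    Finset.smul_sum, Finset.smul_sum, ← Finset.sum_add_distrib]
  refine Finset.sum_congr rfl fun i _ => ?_
  simp [add_smul, mul_smul]

theorem smul_add_mem_rationalWeights {n : ℕ} {q r : ℚ} (hq : 0 ≤ q) (hr : 0 ≤ r)
    (hqr : q + r = 1) {v w : ℕ →₀ ℚ} (hv : v ∈ rationalWeights n) (hw : w ∈ rationalWeights n) :
    q • v + r • w ∈ rationalWeights n := by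
  classical
  have hsub : (q • v + r • w).support ⊆ v.support ∪ w.support :=
    Finsupp.support_add.trans (Finset.union_subset_union Finsupp.support_smul
      Finsupp.support_smul)
  have h : ∀ u : ℕ →₀ ℚ, u.support ⊆ v.support ∪ w.support →
      ∑ i ∈ u.support, u i = ∑ i ∈ v.support ∪ w.support, u i := fun u hu =>
    Finset.sum_subset hu fun i _ hi => Finsupp.notMem_support_iff.1 hi
  refine ⟨fun i => ?_, ?_, fun i hi => ?_⟩
  · have := hv.1 i
    have := hw.1 i
    simp only [Finsupp.add_apply, Finsupp.smul_apply, smul_eq_mul]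
    positivity
  · rw [h _ hsub]
    simp only [Finsupp.add_apply, Finsupp.smul_apply, smul_eq_mul]
    rw [Finset.sum_add_distrib, ← Finset.mul_sum, ← Finset.mul_sum,
      ← h v Finset.subset_union_left, ← h w Finset.subset_union_right, hv.2.1, hw.2.1]
    simpa using hqr
  · rcases Finset.mem_union.1 (hsub hi) with h | h
    exacts [hv.2.2 i h, hw.2.2 i h]

theorem hullStrip_subset {F : ℕ → X → Y} {V W : Set Y} (hVW : V ⊆ W) {n m : ℕ} (h : m ≤ n) :
    hullStrip F V n ⊆ hullStrip F W m := fun _ ⟨w, hw, hp⟩ =>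
  ⟨w, ⟨hw.1, hw.2.1, fun i hi => h.trans (hw.2.2 i hi)⟩, hVW hp⟩

/-- Mixing two centres with a real weight `s` may leave the rational hull. Since `V` is open, a
rational `q` near `s` can replace it in the centre while the point itself keeps `s`. -/
theorem convex_verticalSection_hullStrip [TopologicalSpace Y] [IsTopologicalAddGroup Y]
    [ContinuousSMul ℝ Y] (F : ℕ → X → Y) {V : Set Y} (hVo : IsOpen V) (hVc : Convex ℝ V)
    (n : ℕ) (x : X) : Convex ℝ (verticalSection (hullStrip F V n) x) := by
  rw [convex_iff_openSegment_subset]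
  rintro y₁ ⟨v, hv, h₁⟩ y₂ ⟨w, hw, h₂⟩ _ ⟨s, t, hs, ht, hst, rfl⟩
  simp only at h₁ h₂
  set c := weightedSum F v x
  set d := weightedSum F w x
  have hcont : Continuous fun q : ℝ => s • y₁ + t • y₂ - (q • c + (1 - q) • d) := by fun_prop
  have hs1 : s < 1 := by linarith
  have hmem : s ∈ (fun q : ℝ => s • y₁ + t • y₂ - (q • c + (1 - q) • d)) ⁻¹' V ∩ Ioo 0 1 := by
    refine ⟨?_, hs, hs1⟩
    have := hVc h₁ h₂ hs.le ht.le hst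
    have ht' : 1 - s = t := by linarith
    simp only [mem_preimage, ht']
    convert this using 1
    simp only [smul_sub]
    abel
  obtain ⟨q, hq⟩ := Rat.denseRange_cast.exists_mem_open
    ((hVo.preimage hcont).inter isOpen_Ioo) ⟨s, hmem⟩
  have hq0 : 0 ≤ q := by exact_mod_cast hq.2.1.le
  have hq1 : 0 ≤ 1 - q := by
    have : q < 1 := by exact_mod_cast hq.2.2
    linarith
  refine ⟨q • v + (1 - q) • w, smul_add_mem_rationalWeights hq0 hq1 (by ring) hv hw, ?_⟩
  rw [weightedSum_smul_add]
  simpa using hq.1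

end Strips

theorem isSigma_hullStrip {X Y : Type*} [PseudoMetricSpace X] [AddCommGroup Y] [Module ℝ Y]
    [PseudoMetricSpace Y] [IsTopologicalAddGroup Y] [ContinuousSMul ℝ Y] {b : Ordinal.{0}}
    {F : ℕ → X → Y} (hF : ∀ m, IsBaireClass b (F m)) {V : Set Y} (hVo : IsOpen V) (n : ℕ) :
    IsSigma (Order.succ b) (hullStrip F V n) := by
  have : hullStrip F V n = ⋃ w : ℕ →₀ ℚ,
      {p | w ∈ rationalWeights n ∧ p ∈ (fun p : X × Y => p.2 - weightedSum F w p.1) ⁻¹' V} := by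
    ext p
    simp [hullStrip]
  rw [this]
  refine IsSigma.iUnion_countable (Order.one_le_iff_pos.2 (Order.bot_lt_succ b)) fun w =>
    IsSigma.setOf_const_and (IsBaireClass.isSigma_preimage ?_ hVo)
  exact IsBaireClass.continuous_comp₂ (φ := fun p : Y × Y => p.1 - p.2) (by fun_prop)
    ((IsBaireClass.of_continuous continuous_snd).mono zero_le)
    ((IsBaireClass.finsetSum_smul w.support (fun i => (w i : ℝ)) hF).comp_continuous
      continuous_fst)

/-- A weight `w` contributes the `x` with `weightedSum F w x ∈ U - V`, and `U - V` is open as a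
union of translates of `U`. -/
theorem isSigma_fst_image_hullStrip {X Y : Type*} [PseudoMetricSpace X] [AddCommGroup Y]
    [Module ℝ Y] [PseudoMetricSpace Y] [IsTopologicalAddGroup Y] [ContinuousSMul ℝ Y]
    {b : Ordinal.{0}} {F : ℕ → X → Y} (hF : ∀ m, IsBaireClass b (F m)) {V : Set Y} (n : ℕ)
    {U : Set Y} (hU : IsOpen U) :
    IsSigma (Order.succ b) (Prod.fst '' ((univ ×ˢ U) ∩ hullStrip F V n)) := by
  have : Prod.fst '' ((univ ×ˢ U) ∩ hullStrip F V n) = ⋃ w : ℕ →₀ ℚ,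
      {x | w ∈ rationalWeights n ∧ x ∈ weightedSum F w ⁻¹' ⋃ v ∈ V, {c | c + v ∈ U}} := by
    ext x
    simp only [mem_image, mem_inter_iff, mem_prod, mem_univ, true_and, Prod.exists,
      exists_and_right, exists_eq_right, mem_iUnion, mem_ofPred_eq, mem_preimage, exists_prop,
      hullStrip]
    constructor
    · rintro ⟨y, hy, w, hw, h⟩
      exact ⟨w, hw, _, h, by simpa using hy⟩
    · rintro ⟨w, hw, v, hv, h⟩
      exact ⟨_, h, w, hw, by simpa using hv⟩
  rw [this]
  refine IsSigma.iUnion_countable (Order.one_le_iff_pos.2 (Order.bot_lt_succ b)) fun w =>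
    IsSigma.setOf_const_and (IsBaireClass.isSigma_preimage
      (IsBaireClass.finsetSum_smul w.support (fun i => (w i : ℝ)) hF) ?_)
  exact isOpen_biUnion fun v _ => hU.preimage (continuous_add_const v)

/-! ### Strips shrink to the graph of the limit -/

section Convergence

variable {X Y : Type*} [AddCommGroup Y] [Module ℝ Y] [PseudoMetricSpace Y]
  [IsTopologicalAddGroup Y]

theorem mem_hullStrip_of_tendsto {F : ℕ → X → Y} {f : X → Y} {x : X}
    (hlim : Tendsto (fun n => F n x) atTop (𝓝 (f x))) {V : Set Y} (hV0 : (0 : Y) ∈ V)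
    (hVo : IsOpen V) (n : ℕ) : (x, f x) ∈ hullStrip F V n := by
  have h : Tendsto (fun m => f x - F m x) atTop (𝓝 0) := by
    simpa using (tendsto_const_nhds (x := f x)).sub hlim
  obtain ⟨m, hm, hnm⟩ :=
    ((h.eventually (hVo.mem_nhds hV0)).and (eventually_ge_atTop n)).exists
  exact ⟨_, single_mem_rationalWeights hnm, by rwa [weightedSum_single]⟩

/-- Far out, all `F i x` lie in the convex set `f x + V k`, hence so do their convex combinations;
the section then lies in `f x + V k + V k`, inside a small ball. -/
theorem tendsto_ediam_hullStrip {F : ℕ → X → Y} {f : X → Y} {x : X}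
    (hlim : Tendsto (fun n => F n x) atTop (𝓝 (f x))) {V : ℕ → Set Y}
    (hVc : ∀ n, (0 : Y) ∈ V n ∧ IsOpen (V n) ∧ Convex ℝ (V n))
    (hV : (𝓝 (0 : Y)).HasAntitoneBasis V) :
    Tendsto (fun n => Metric.ediam (verticalSection (hullStrip F (V n) n) x)) atTop (𝓝 0) := by
  rw [ENNReal.tendsto_nhds_zero]
  intro ε hε
  obtain ⟨δ, hδ, hδε⟩ : ∃ δ : ENNReal, 0 < δ ∧ δ + δ ≤ ε :=
    ⟨ε / 2, ENNReal.half_pos hε.ne', (ENNReal.add_halves ε).le⟩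
  have hadd : Tendsto (fun p : Y × Y => f x + p.1 + p.2) (𝓝 0 ×ˢ 𝓝 0) (𝓝 (f x)) := by
    have : Continuous fun p : Y × Y => f x + p.1 + p.2 := by fun_prop
    simpa [nhds_prod_eq] using this.tendsto (0, 0)
  obtain ⟨k, -, hk⟩ := (hV.prod hV).1.mem_iff.1 (hadd (Metric.eball_mem_nhds (f x) hδ))
  have hlim0 : Tendsto (fun m => F m x - f x) atTop (𝓝 0) := by
    simpa using hlim.sub_const (f x)
  obtain ⟨N, hN⟩ := eventually_atTop.1
    (hlim0.eventually ((hVc k).2.1.mem_nhds (hVc k).1))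
  filter_upwards [eventually_ge_atTop N, eventually_ge_atTop k] with n hn hkn
  have hball : verticalSection (hullStrip F (V n) n) x ⊆ Metric.eball (f x) δ := by
    rintro y ⟨w, hw, hy⟩
    have hc : weightedSum F w x ∈ {c | c - f x ∈ V k} := by
      refine weightedSum_mem hw ?_ fun i hi => hN i (hn.trans hi)
      have : {c | c - f x ∈ V k} = (fun z => z + -f x) ⁻¹' V k := by
        ext c
        simp [sub_eq_add_neg]
      rw [this]
      exact (hVc k).2.2.translate_preimage_left _
    have := @hk (weightedSum F w x - f x, y - weightedSum F w x) ⟨hc, hV.2 hkn hy⟩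
    simpa using this
  exact (Metric.ediam_mono hball).trans (Metric.ediam_eball_le.trans (by rwa [two_mul]))

end Convergence

/-! ### The characterisation -/

theorem theorem1p7 {X : Type*} [MetricSpace X] (hX : IsSuslinSpace X)
    {Y : Type*} [AddCommGroup Y] [Module ℝ Y] [MetricSpace Y]
    [IsTopologicalAddGroup Y] [ContinuousSMul ℝ Y] [LocallyConvexSpace ℝ Y] [CompleteSpace Y]
    (hdist : ∀ a b c : Y, dist (a + c) (b + c) = dist a b)
    [TopologicalSpace.SeparableSpace Y]
    (α : Ordinal.{0}) (hα : α < ω₁) (hsucc : ∃ β : Ordinal.{0}, α = Order.succ β)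
    (f : X → Y) :
    IsBaireClass α f ↔
      ∃ G : ℕ → Set (X × Y),
        Antitone G ∧
        (∀ n, IsSigmaStrip α (G n)) ∧
        (⋂ n, G n) = {p : X × Y | p.2 = f p.1} ∧
        (∀ x, Tendsto (fun n => Metric.ediam (verticalSection (G n) x)) atTop (𝓝 0)) ∧
        (∀ n, ∀ U : Set Y, IsOpen U →
          IsSigma α (Prod.fst '' ((Set.univ ×ˢ U) ∩ G n))) := by
  obtain ⟨V, hVc, hV⟩ := exists_antitone_basis_open_convex Y
  obtain ⟨b, rfl⟩ := hsucc
  constructor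
  · intro hf
    obtain ⟨a, F, ha, hF, hlim⟩ := hf.exists_tendsto (Order.bot_lt_succ b)
    -- As `α` is a successor, all approximants share the single class `b`.
    have hFb : ∀ n, IsBaireClass b (F n) := fun n => (hF n).mono (Order.lt_succ_iff.1 (ha n))
    have hdiam := fun x => tendsto_ediam_hullStrip (hlim x) hVc hV
    have hmem := fun n x => mem_hullStrip_of_tendsto (hlim x) (hVc n).1 (hVc n).2.1 n
    refine ⟨fun n => hullStrip F (V n) n, fun m n h => hullStrip_subset (hV.2 h) h,
      fun n => ⟨isSigma_hullStrip hFb (hVc n).2.1 n,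
        convex_verticalSection_hullStrip F (hVc n).2.1 (hVc n).2.2 n⟩, ?_, hdiam,
      fun n U hU => isSigma_fst_image_hullStrip hFb n hU⟩
    ext ⟨x, y⟩
    simp only [mem_iInter, mem_ofPred_eq]
    constructor
    · intro h
      refine edist_le_zero.1 (ge_of_tendsto' (hdiam x) fun n => ?_)
      exact Metric.edist_le_ediam_of_mem (h n) (hmem n x)
    · rintro rfl n
      exact hmem n x
  · rintro ⟨G, -, hstrip, hgraph, hdiam, hproj⟩
    have hmem : ∀ n x, f x ∈ verticalSection (G n) x := fun n x =>
      mem_iInter.1 (hgraph.symm ▸ (rfl : f x = f x) : (x, f x) ∈ ⋂ n, G n) n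
    have hsel : ∀ n, ∃ g : X → Y, IsBaireClass b g ∧
        ∀ x, ∃ z ∈ verticalSection (G n) x, g x - z ∈ V n := fun n => by
      refine exists_baire_approximate_selection (hstrip n).2 (fun x => ⟨_, hmem n x⟩)
        (fun U hU => ?_) (hVc n).1 (hVc n).2.1 (hVc n).2.2
      convert hproj n U hU using 1
      ext x
      simp [Set.Nonempty, verticalSection]
    choose g hg z hz hgz using hsel
    refine .of_tendsto (fun _ => b) g (fun _ => Order.lt_succ b) hg fun x => ?_
    -- Both `z n x` and `f x` lie in the section of `G n`, whose diameter tends to `0`.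
    have hz' : Tendsto (fun n => z n x) atTop (𝓝 (f x)) := by
      rw [tendsto_iff_edist_tendsto_0]
      exact tendsto_of_tendsto_of_tendsto_of_le_of_le tendsto_const_nhds (hdiam x)
        (fun _ => zero_le) fun n => Metric.edist_le_ediam_of_mem (hz n x) (hmem n x)
    have hv : Tendsto (fun n => g n x - z n x) atTop (𝓝 0) := hV.tendsto fun n => hgz n x
    simpa using hv.add hz'
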